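/- Let $\mathbb F$ be a field of characteristic $\neq 2$, and let $M=(M_k)_{k\in\mathbb N}$ be a sequence of matrices over $\mathbb F$, where $M_k$ is an $n_k^{d_k}\times n_k^{d_k}$ matrix with integers $n_k,d_k\ge 1$, its rows and columns indexed by $[n_k]^{d_k}$. (For instance $n$ runs over the positive integers and $d=d(n)$ is a function of $n$.) Below the index $k$ is dropped. For $\kappa\subseteq[d]$ let $M^{\top_\kappa}$ be the matrix obtained from $M$ by swapping the row index $i_l$ with the column index $j_l$ for every $l\in\kappa$. A matrix $P$ is PT-basic if $\mathrm{rank}(P^{\top_\kappa})=1$ for some $\kappa\subseteq[d]$, and $\mathrm{PT\text{-}rank}(M)$ is the minimum number of PT-basic matrices whose sum is $M$. Let $\langle\cdot,\cdot\rangle:[n]^2\to[n^2]$ be the bijection $\langle i,j\rangle=(i-1)n+j$. The shifted tensor of $M$ is the tensor $A:[n^2]^{d+1}\to\mathbb F$ with $$A(\langle p,i_1\rangle,\langle j_1,i_2\rangle,\dots,\langle j_{d-1},i_d\rangle,\langle j_d,q\rangle)=\begin{cases}M_{(i_1,\dots,i_d),(j_1,\dots,j_d)}&\text{if }p=q=1,\\0&\text{otherwise.}\end{cases}$$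 Its set-multilinear polynomial is $P_A=\sum_{a}A(a_0,\dots,a_d)\,X^{(0)}_{a_0}\cdots X^{(d)}_{a_d}$, a polynomial in $N=(d+1)n^2$ variables. An ordered algebraic branching program for $P_A$ is an expression $P_A=v_1^{\mathsf T}L_0L_1\cdots L_d\,v_2$, where $v_1\in\mathbb F^{w_0}$ and $v_2\in\mathbb F^{w_{d+1}}$ are constant vectors and $L_i$ is a $w_i\times w_{i+1}$ matrix whose entries are $\mathbb F$-linear combinations of the variables $X^{(i)}_1,\dots,X^{(i)}_{n^2}$; its size is $w_0+\dots+w_{d+1}$. Suppose that the shifted tensors of the sequence $M$ are in $\mathsf{VBP_{ord}}$, that is, their polynomials have ordered algebraic branching programs whose size is bounded by a fixed polynomial in the number $N$ of variables. Then $\mathrm{PT\text{-}rank}(M)\le n^{0.81d+O(1)}$; that is, there is a real constant $C$ such that $\mathrm{PT\text{-}rank}(M_k)\le n_k^{0.81d_k+C}$ for all $k$. -/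

import Mathlib

/-! ## Partial transpose rank -/

/-- The `κ`-partial transpose of an `n^d × n^d` matrix (rows and columns indexed by `d`-tuples):
for every `k ∈ κ` the `k`-th row index and the `k`-th column index are swapped. -/
def partialTranspose {F : Type*} {n d : ℕ} (κ : Finset (Fin d))
    (M : Matrix (Fin d → Fin n) (Fin d → Fin n) F) :
    Matrix (Fin d → Fin n) (Fin d → Fin n) F :=
  Matrix.of fun i j =>
    M (fun k => if k ∈ κ then j k else i k) (fun k => if k ∈ κ then i k else j k)

/-- A matrix is PT-basic if one of its partial transposes has rank `1`. -/
def PTBasic {F : Type*} [Field F] {n d : ℕ}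
    (P : Matrix (Fin d → Fin n) (Fin d → Fin n) F) : Prop :=
  ∃ κ : Finset (Fin d), (partialTranspose κ P).rank = 1

/-- `M` is a sum of `r` PT-basic matrices. -/
def IsPTSum {F : Type*} [Field F] {n d : ℕ}
    (M : Matrix (Fin d → Fin n) (Fin d → Fin n) F) (r : ℕ) : Prop :=
  ∃ P : Fin r → Matrix (Fin d → Fin n) (Fin d → Fin n) F,
    (∀ t, PTBasic (P t)) ∧ M = ∑ t, P t

/-- Every matrix is a sum of finitely many PT-basic matrices, so that the minimum in the
definition of the PT-rank is attained. -/
theorem exists_isPTSum {F : Type*} [Field F] {n d : ℕ}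
    (M : Matrix (Fin d → Fin n) (Fin d → Fin n) F) : ∃ r, IsPTSum M r := by
  classical
  induction M using Matrix.induction_on' with
  | h_zero => exact ⟨0, Fin.elim0, fun t => t.elim0, by simp⟩
  | h_add p q hp hq =>
    obtain ⟨r, P, hP, rfl⟩ := hp
    obtain ⟨s, Q, hQ, rfl⟩ := hq
    refine ⟨r + s, Fin.append P Q, fun t => ?_, by simp [Fin.sum_univ_add]⟩
    induction t using Fin.addCases with
    | left t => simpa using hP t
    | right t => simpa using hQ t
  | h_std_basis i j x =>
    by_cases hx : x = 0
    · exact ⟨0, Fin.elim0, fun t => t.elim0, by simp [hx]⟩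
    · refine ⟨1, fun _ => Matrix.single i j x, fun _ => ⟨∅, ?_⟩, by simp⟩
      have h : partialTranspose ∅ (Matrix.single i j x) = Matrix.single i j x := by
        ext a b
        simp [partialTranspose]
      rw [h]
      apply le_antisymm
      · have h1 : Matrix.single i j x =
            Matrix.vecMulVec (Pi.single i x) (Pi.single j (1 : F)) := by
          ext a b
          by_cases ha : i = a <;> by_cases hb : j = b <;>
            simp [Matrix.single, Matrix.vecMulVec, Pi.single_apply, ha, hb, eq_comm]
        rw [h1]
        exact Matrix.rank_vecMulVec_le _ _
      · rw [Nat.one_le_iff_ne_zero]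
        intro h0
        have h2 : (Matrix.single i j x).mulVecLin = 0 :=
          LinearMap.range_eq_bot.mp (Submodule.finrank_eq_zero.mp h0)
        have h3 := congrFun (LinearMap.congr_fun h2 (Pi.single j 1)) i
        simp at h3
        exact hx h3

/-- The PT-rank of `M`: the minimum number of PT-basic matrices that sum to `M`. -/
noncomputable def ptRank {F : Type*} [Field F] {n d : ℕ}
    (M : Matrix (Fin d → Fin n) (Fin d → Fin n) F) : ℕ :=
  sInf {r | IsPTSum M r}

/-! ## The shifted tensor -/

/-- The shifted tensor `[n²]^(d+1) → F` of an `n^d × n^d` matrix. The bijection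
`finProdFinEquiv : (x, y) ↦ n * x + y` pairs two indices of `[n]` into one index of `[n²]`. At
`(⟨p, i₁⟩, ⟨j₁, i₂⟩, …, ⟨j_{d-1}, i_d⟩, ⟨j_d, q⟩)` the value is the entry
`M (i₁, …, i_d) (j₁, …, j_d)` if `p` and `q` are both the first index, and `0` otherwise. -/
def shiftedTensor {F : Type*} [Zero F] {n d : ℕ}
    (M : Matrix (Fin d → Fin n) (Fin d → Fin n) F) : (Fin (d + 1) → Fin (n * n)) → F :=
  fun a =>
    if ((finProdFinEquiv.symm (a 0)).1 : ℕ) = 0 ∧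
        ((finProdFinEquiv.symm (a (Fin.last d))).2 : ℕ) = 0 then
      M (fun k => (finProdFinEquiv.symm (a k.castSucc)).2)
        (fun k => (finProdFinEquiv.symm (a k.succ)).1)
    else 0

/-! ## Set-multilinear polynomials and ordered algebraic branching programs -/

/-- The set-multilinear polynomial of a tensor `A : [q]^m → F`, in the `m` blocks of variables
`X (i, 0), …, X (i, q - 1)`: the sum of `A a * X (0, a 0) * ⋯ * X (m - 1, a (m - 1))`. -/
noncomputable def tensorPoly {F : Type*} [Field F] {m q : ℕ} (A : (Fin m → Fin q) → F) :
    MvPolynomial (Fin m × Fin q) F :=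
  ∑ a : Fin m → Fin q, MvPolynomial.C (A a) * ∏ i, MvPolynomial.X (i, a i)

/-- An ordered algebraic branching program over `F` in `m` blocks of `q` variables: layer widths
`w_0, …, w_m`, two constant vectors, and for each block `i` a `w_i × w_{i+1}` matrix of linear
combinations of the variables of that block, given by their coefficients. -/
structure OrderedABP (F : Type*) (m q : ℕ) where
  /-- the widths of the `m + 1` layers -/
  width : Fin (m + 1) → ℕ
  /-- the constant vector on the left -/
  source : Fin (width 0) → F
  /-- the constant vector on the right -/
  sink : Fin (width (Fin.last m)) → F
  /-- `coeff i r c a` is the coefficient of the variable `X (i, a)` in the `(r, c)` entry of the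
  matrix of block `i` -/
  coeff : (i : Fin m) → Fin (width i.castSucc) → Fin (width i.succ) → Fin q → F

namespace OrderedABP

/-- The matrix of block `i`, whose entries are linear forms in the variables of that block. -/
noncomputable def layer {F : Type*} [Field F] {m q : ℕ} (B : OrderedABP F m q) (i : Fin m) :
    Matrix (Fin (B.width i.castSucc)) (Fin (B.width i.succ)) (MvPolynomial (Fin m × Fin q) F) :=
  Matrix.of fun r c => ∑ a, MvPolynomial.C (B.coeff i r c a) * MvPolynomial.X (i, a)

/-- The row vector `v₁ᵀ M₁ ⋯ M_k`. -/
noncomputable def row {F : Type*} [Field F] {m q : ℕ} (B : OrderedABP F m q) (k : Fin (m + 1)) :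
    Fin (B.width k) → MvPolynomial (Fin m × Fin q) F :=
  Fin.induction (motive := fun k => Fin (B.width k) → MvPolynomial (Fin m × Fin q) F)
    (fun r => MvPolynomial.C (B.source r))
    (fun i v => Matrix.vecMul v (B.layer i)) k

/-- The polynomial `v₁ᵀ M₁ ⋯ M_m v₂` computed by the program. -/
noncomputable def poly {F : Type*} [Field F] {m q : ℕ} (B : OrderedABP F m q) :
    MvPolynomial (Fin m × Fin q) F :=
  dotProduct (B.row (Fin.last m)) (fun r => MvPolynomial.C (B.sink r))

/-- The size of the program: the sum of the widths of its layers. -/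
def size {F : Type*} {m q : ℕ} (B : OrderedABP F m q) : ℕ :=
  ∑ i, B.width i

end OrderedABP

/-- A sequence of tensors `A k : [q k]^(m k) → F` is in `VBP_ord` if the associated set-multilinear
polynomials, in `m k * q k` variables, are computed by ordered algebraic branching programs whose
size is polynomial in the number of variables. -/
def VBPord {F : Type*} [Field F] {m q : ℕ → ℕ} (A : ∀ k, (Fin (m k) → Fin (q k)) → F) : Prop :=
  ∃ c : ℕ, ∀ k, ∃ B : OrderedABP F (m k) (q k),
    B.poly = tensorPoly (A k) ∧ B.size ≤ (m k * q k) ^ c + c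

/-! ## Splitting a product of two Kronecker deltas -/

/-! An ordered program makes the entries of `M` bilinear expressions in a product of `d + 1`
matrices. Cut the product into four runs of about `d / 4` factors. Each cut costs a sum over the
program states and over one index, hence only a factor `W * n`, with `W` the size of the program. A
run depends on about `d / 4` index pairs, so it is a sum of about `n ^ (d / 4)` products `u * v`
that separate the two indices of every pair. Such a product is a matrix one of whose partial
transposes has rank at most `1`, and it is free which index of each pair goes into `u`.

Merging two runs with `r = 4 ^ s` terms each would naively give `r ^ 2 = 16 ^ s` terms. But the
factors can be grouped as `u u' | v v'` or as `u v' | v u'`, and both groupings are allowed in one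
sum. With the summation indices written in bits, the tensor to decompose is a power of `δ_{aa'}
δ_{bb'} = ε_{ab} ε_{a'b'} + δ_{ab'} δ_{a'b}`, where each summand has rank one for one of the
groupings. In the expanded power one summand is used at least half of the time, which bounds the
rank in its grouping by `12 ^ s` (`exists_delta_mul_delta_split`, `HasSplit.exists_mul_eq_add`). Two
rounds of merging give the exponent `(log_4 12) ^ 2 / 4 < 0.804`, and the gap to `0.81` absorbs the
powers of `d` in the program size. -/

/-- The number of words of length `2 * s` over four letters with at least `s` zeros is at most
`12 ^ s`. -/
theorem card_words_le (s : ℕ) :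
    Fintype.card {c : Fin (2 * s) → Fin 4 // s ≤ (Finset.univ.filter fun k => c k = 0).card}
      ≤ 12 ^ s := by
  classical
  rw [Fintype.card_subtype]
  set S := Finset.univ.filter
    fun c : Fin (2 * s) → Fin 4 => s ≤ (Finset.univ.filter fun k => c k = 0).card
  -- Exponential weights: a zero weighs 3 and any other letter 1. A word in `S` weighs at least `3 ^
  -- s`, and all words together weigh `(3 + 1 + 1 + 1) ^ (2 * s) = 36 ^ s`.
  have h1 : S.card * 3 ^ s ≤ ∑ c : Fin (2 * s) → Fin 4, ∏ k, (if c k = 0 then 3 else 1) := by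
    calc S.card * 3 ^ s = ∑ _c ∈ S, 3 ^ s := by simp
      _ ≤ ∑ c ∈ S, ∏ k, (if c k = 0 then 3 else 1) := by
        refine Finset.sum_le_sum fun c hc => ?_
        rw [Finset.prod_ite]
        simp only [Finset.prod_const, one_pow, mul_one]
        exact Nat.pow_le_pow_right (by norm_num) (Finset.mem_filter.mp hc).2
      _ ≤ _ := Finset.sum_le_sum_of_subset (Finset.subset_univ _)
  have h2 : ∑ c : Fin (2 * s) → Fin 4, ∏ k, (if c k = 0 then 3 else 1) = 12 ^ s * 3 ^ s := by
    have h := Finset.prod_univ_sum (fun _ : Fin (2 * s) => (Finset.univ : Finset (Fin 4)))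
      (fun _ c => if c = 0 then 3 else 1)
    rw [Fintype.piFinset_univ] at h
    rw [← h]
    simp [Fin.sum_univ_succ, pow_mul, ← mul_pow]
  rw [h2] at h1
  exact Nat.le_of_mul_le_mul_right h1 (by positivity)

/-- If `E = ∑ α c * β c` and `E' = α 0 * γ`, then the terms of the expansion of `∏ (E' + E)` in
which `E'` is taken at least `s` times are spanned by the products of `α`'s containing `α 0` at
least `s` times. -/
theorem sum_prod_large_eq {R X Y : Type*} [CommRing R] {m : ℕ} (s : ℕ)
    (S : Finset (Finset (Fin m))) (hS : ∀ U ∈ S, s ≤ U.card)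
    (α : Fin 4 → X → R) (β : Fin 4 → Y → R) (γ : Y → R) (x : Fin m → X) (y : Fin m → Y) :
    ∑ U ∈ S, (∏ k ∈ U, α 0 (x k) * γ (y k)) *
        ∏ k ∈ Finset.univ \ U, ∑ c, α c (x k) * β c (y k) =
      ∑ c : {c : Fin m → Fin 4 // s ≤ (Finset.univ.filter fun k => c k = 0).card},
        (∏ k, α (c.1 k) (x k)) *
          ∑ U ∈ S, ∏ k,
            (if k ∈ U then (if c.1 k = 0 then γ (y k) else 0) else β (c.1 k) (y k)) := by
  classical
  have h1 : ∀ U : Finset (Fin m),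
      (∏ k ∈ U, α 0 (x k) * γ (y k)) * ∏ k ∈ Finset.univ \ U, ∑ c, α c (x k) * β c (y k) =
      ∑ c : Fin m → Fin 4, (∏ k, α (c k) (x k)) *
        ∏ k, (if k ∈ U then (if c k = 0 then γ (y k) else 0) else β (c k) (y k)) := by
    intro U
    have h := Finset.prod_univ_sum (fun _ : Fin m => (Finset.univ : Finset (Fin 4)))
      (fun k c => α c (x k) * (if k ∈ U then (if c = 0 then γ (y k) else 0) else β c (y k)))
    rw [Fintype.piFinset_univ] at h
    simp only [← Finset.prod_mul_distrib]
    rw [← h, ← Finset.prod_mul_prod_compl U, ← Finset.compl_eq_univ_sdiff]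
    congr 1
    · refine Finset.prod_congr rfl fun k hk => ?_
      simp [hk]
    · refine Finset.prod_congr rfl fun k hk => ?_
      simp [Finset.mem_compl.mp hk]
  simp only [h1]
  rw [Finset.sum_comm]
  simp only [← Finset.mul_sum]
  rw [← Finset.sum_subtype
    (Finset.univ.filter fun c : Fin m → Fin 4 => s ≤ (Finset.univ.filter fun k => c k = 0).card)
    (by simp) (fun c : Fin m → Fin 4 => (∏ k, α (c k) (x k)) *
      ∑ U ∈ S, ∏ k, (if k ∈ U then (if c k = 0 then γ (y k) else 0) else β (c k) (y k)))]
  -- A word with fewer than `s` zeros has a nonzero letter at some position of each `U ∈ S`, where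
  -- the coefficient vanishes.
  refine (Finset.sum_subset (Finset.subset_univ _) fun c _ hc => ?_).symm
  rw [Finset.sum_eq_zero, mul_zero]
  intro U hU
  obtain ⟨k, hk, hck⟩ : ∃ k ∈ U, c k ≠ 0 := by
    by_contra! hcon
    refine hc (Finset.mem_filter.mpr ⟨Finset.mem_univ _, (hS U hU).trans ?_⟩)
    exact Finset.card_le_card fun k hk => Finset.mem_filter.mpr ⟨Finset.mem_univ _, hcon k hk⟩
  exact Finset.prod_eq_zero (Finset.mem_univ k) (by simp [hk, hck])

/-- The indicator function of a pair of bits. -/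
def bitPair (R : Type*) [CommRing R] (p q : Bool) (x : Bool × Bool) : R :=
  if x = (p, q) then 1 else 0

/-- The product of the deltas of the pairs `(a, a')` and `(b, b')` of words of length `2 * s` is a
sum of few functions that split as `(a, b) | (a', b')` and few functions that split as
`(a, b') | (a', b)`. -/
theorem exists_delta_mul_delta_split (R : Type*) [CommRing R] (s : ℕ) :
    ∃ (ι : Type) (_ : Fintype ι), Fintype.card ι ≤ 12 ^ s ∧
      ∃ A B A' B' : ι → (Fin (2 * s) → Bool) → (Fin (2 * s) → Bool) → R, ∀ a a' b b',
        (if a = a' then 1 else 0) * (if b = b' then 1 else 0) =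
          ∑ c, A c a b * B c a' b' + ∑ c, A' c a b' * B' c a' b := by
  classical
  let e := bitPair R
  -- `α 0` is the alternating form `ε` and `α' 0` is the delta. Each is completed to a basis of the
  -- functions of two bits, so that the term native to the other grouping expands in a basis
  -- containing it.
  let α : Fin 4 → Bool × Bool → R :=
    ![e false true - e true false, e false false, e true true, e true false]
  let β : Fin 4 → Bool × Bool → R :=
    ![e true false, e false false, e true true, e true false + e false true]
  let α' : Fin 4 → Bool × Bool → R :=
    ![e false false + e true true, e false true, e true false, e false false]
  let β' : Fin 4 → Bool × Bool → R :=
    ![-e false false, e false true, e true false, e false false - e true true]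
  -- The Plücker relation for 2 × 2 determinants.
  have hpair : ∀ a a' b b' : Bool, (if a = a' then (1 : R) else 0) * (if b = b' then 1 else 0) =
      α 0 (a, b) * α 0 (a', b') + α' 0 (a, b') * α' 0 (a', b) := by
    intro a a' b b'
    cases a <;> cases a' <;> cases b <;> cases b' <;> simp [α, α', e, bitPair]
  have hswap : ∀ a a' b b' : Bool,
      α' 0 (a, b') * α' 0 (a', b) = ∑ c, α c (a, b) * β c (a', b') := by
    intro a a' b b'
    cases a <;> cases a' <;> cases b <;> cases b' <;>
      simp [α, α', β, e, bitPair, Fin.sum_univ_succ]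
  have halt : ∀ a a' b b' : Bool,
      α 0 (a, b) * α 0 (a', b') = ∑ c, α' c (a, b') * β' c (a', b) := by
    intro a a' b b'
    cases a <;> cases a' <;> cases b <;> cases b' <;>
      simp [α, α', β', e, bitPair, Fin.sum_univ_succ]
  let S : Finset (Finset (Fin (2 * s))) := Finset.univ.filter fun U => s ≤ U.card
  -- If `ε ε` is taken fewer than `s` times out of `2 * s`, the other summand is taken at least `s`
  -- times; `S'` collects the positions of the latter.
  let S' : Finset (Finset (Fin (2 * s))) := (Finset.univ.filter fun U => ¬ s ≤ U.card).map
    ⟨compl, compl_injective⟩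
  have hS : ∀ U ∈ S, s ≤ U.card := fun U hU => (Finset.mem_filter.mp hU).2
  have hS' : ∀ U ∈ S', s ≤ U.card := by
    intro U hU
    obtain ⟨V, hV, rfl⟩ := Finset.mem_map.mp hU
    have := (Finset.mem_filter.mp hV).2
    simp only [Function.Embedding.coeFn_mk, Finset.card_compl, Fintype.card_fin]
    omega
  refine ⟨{c : Fin (2 * s) → Fin 4 // s ≤ (Finset.univ.filter fun k => c k = 0).card},
    inferInstance, card_words_le s,
    fun c a b => ∏ k, α (c.1 k) (a k, b k),
    fun c a' b' => ∑ U ∈ S, ∏ k,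
      (if k ∈ U then (if c.1 k = 0 then α 0 (a' k, b' k) else 0) else β (c.1 k) (a' k, b' k)),
    fun c a b' => ∏ k, α' (c.1 k) (a k, b' k),
    fun c a' b => ∑ U ∈ S', ∏ k,
      (if k ∈ U then (if c.1 k = 0 then α' 0 (a' k, b k) else 0) else β' (c.1 k) (a' k, b k)),
    fun a a' b b' => ?_⟩
  have hdelta : ∀ a a' : Fin (2 * s) → Bool,
      (if a = a' then (1 : R) else 0) = ∏ k, if a k = a' k then 1 else 0 := by
    intro a a'
    by_cases h : a = a'
    · simp [h]
    · obtain ⟨k, hk⟩ := Function.ne_iff.mp h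
      rw [if_neg h, Finset.prod_eq_zero (Finset.mem_univ k) (if_neg hk)]
  rw [hdelta, hdelta, ← Finset.prod_mul_distrib, Finset.prod_congr rfl fun k _ => hpair _ _ _ _,
    Finset.prod_add, Finset.powerset_univ,
    ← Finset.sum_filter_add_sum_filter_not Finset.univ (fun U => s ≤ U.card)]
  congr 1
  · rw [← sum_prod_large_eq s S hS α β (α 0) (fun k => (a k, b k)) (fun k => (a' k, b' k))]
    exact Finset.sum_congr rfl fun U _ => by simp only [hswap]
  · rw [← sum_prod_large_eq s S' hS' α' β' (α' 0) (fun k => (a k, b' k)) (fun k => (a' k, b k)),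
      Finset.sum_map]
    refine Finset.sum_congr rfl fun U _ => ?_
    simp only [Function.Embedding.coeFn_mk, halt]
    rw [← Finset.compl_eq_univ_sdiff, ← Finset.compl_eq_univ_sdiff, compl_compl, mul_comm]

/-! ## Functions that split -/

/-- `f` is a sum of at most `r` products `u * v`, where for every pair `k ∈ B` of variables `(k, false)`,
`(k, true)` one depends on the first factor only, the other one on the second factor only. -/
def HasSplit {F ι α : Type*} [Field F] (B : Set ι) (r : ℕ) (f : (ι × Bool → α) → F) : Prop :=
  ∃ (κ : ι → Bool) (τ : Type) (_ : Fintype τ) (u v : τ → (ι × Bool → α) → F),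
    Fintype.card τ ≤ r ∧ (∀ t, DependsOn (u t) {p | p.1 ∈ B ∧ p.2 = κ p.1}) ∧
      (∀ t, DependsOn (v t) {p | p.1 ∈ B ∧ p.2 ≠ κ p.1}) ∧ ∀ ω, f ω = ∑ t, u t ω * v t ω

/-- `f` is a sum of at most `c` functions each of which is a sum of at most `r` products for some common split. -/
def IsSumOfSplits {F ι α : Type*} [Field F] (B : Set ι) (r c : ℕ) (f : (ι × Bool → α) → F) :
    Prop :=
  ∃ (σ : Type) (_ : Fintype σ) (g : σ → (ι × Bool → α) → F),
    Fintype.card σ ≤ c ∧ (∀ x, HasSplit B r (g x)) ∧ ∀ ω, f ω = ∑ x, g x ω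

section

variable {F ι α : Type*} [Field F] {B B' : Set ι}

theorem dependsOn_mul {f g : (ι × Bool → α) → F} {s t u : Set (ι × Bool)} (hf : DependsOn f s)
    (hg : DependsOn g t) (hs : s ⊆ u) (ht : t ⊆ u) : DependsOn (fun ω => f ω * g ω) u := by
  intro x y h
  simp only
  rw [hf fun i hi => h i (hs hi), hg fun i hi => h i (ht hi)]

theorem dependsOn_sum {τ : Type*} (T : Finset τ) {f : τ → (ι × Bool → α) → F}
    {s : Set (ι × Bool)} (hf : ∀ t, DependsOn (f t) s) : DependsOn (fun ω => ∑ t ∈ T, f t ω) s :=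
  fun _ _ h => Finset.sum_congr rfl fun t _ => hf t h

theorem HasSplit.mono {r r' : ℕ} {f : (ι × Bool → α) → F} (h : HasSplit B r f) (hr : r ≤ r') :
    HasSplit B r' f := by
  obtain ⟨κ, τ, _, u, v, hc, h⟩ := h
  exact ⟨κ, τ, _, u, v, hc.trans hr, h⟩

theorem IsSumOfSplits.mono {r r' c : ℕ} {f : (ι × Bool → α) → F} (h : IsSumOfSplits B r c f)
    (hr : r ≤ r') : IsSumOfSplits B r' c f := by
  obtain ⟨σ, _, g, hc, hg, h⟩ := h
  exact ⟨σ, _, g, hc, fun x => (hg x).mono hr, h⟩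

theorem HasSplit.isSumOfSplits {r : ℕ} {f : (ι × Bool → α) → F} (h : HasSplit B r f) :
    IsSumOfSplits B r 1 f :=
  ⟨Unit, inferInstance, fun _ => f, by simp, fun _ => h, by simp⟩

/-- The merging step. The two summands have different splits: one keeps both given orientations, the
other reverses the orientation on `B'`. -/
theorem HasSplit.exists_mul_eq_add {s : ℕ} {f g : (ι × Bool → α) → F} (hB : Disjoint B B')
    (hf : HasSplit B (4 ^ s) f) (hg : HasSplit B' (4 ^ s) g) :
    ∃ p q, HasSplit (B ∪ B') (12 ^ s) p ∧ HasSplit (B ∪ B') (12 ^ s) q ∧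
      ∀ ω, f ω * g ω = p ω + q ω := by
  classical
  obtain ⟨κ, τ, _, u, v, hτ, hu, hv, hf⟩ := hf
  obtain ⟨κ', τ', _, u', v', hτ', hu', hv', hg⟩ := hg
  have hw : Fintype.card (Fin (2 * s) → Bool) = 4 ^ s := by
    simp [pow_mul]
  obtain ⟨e⟩ : Nonempty (τ ↪ (Fin (2 * s) → Bool)) :=
    Function.Embedding.nonempty_of_card_le (by rwa [hw])
  obtain ⟨e'⟩ : Nonempty (τ' ↪ (Fin (2 * s) → Bool)) :=
    Function.Embedding.nonempty_of_card_le (by rwa [hw])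
  obtain ⟨ν, _, hν, P, Q, P', Q', hPQ⟩ := exists_delta_mul_delta_split F s
  have hmem : ∀ {k}, k ∈ B' → k ∉ B := fun h h' => Set.disjoint_left.mp hB h' h
  refine ⟨fun ω => ∑ c, (∑ t, ∑ t', P c (e t) (e' t') * (u t ω * u' t' ω)) *
      (∑ t, ∑ t', Q c (e t) (e' t') * (v t ω * v' t' ω)),
    fun ω => ∑ c, (∑ t, ∑ t', P' c (e t) (e' t') * (u t ω * v' t' ω)) *
      (∑ t, ∑ t', Q' c (e t) (e' t') * (v t ω * u' t' ω)), ?_, ?_, fun ω => ?_⟩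
  · refine ⟨fun k => if k ∈ B then κ k else κ' k, ν, _, _, _, hν, fun c => ?_, fun c => ?_,
      fun ω => rfl⟩
    · refine dependsOn_sum _ fun t => dependsOn_sum _ fun t' x y h => congrArg _ ?_
      refine dependsOn_mul (hu t) (hu' t') ?_ ?_ h
      · rintro p ⟨h1, h2⟩
        exact ⟨Or.inl h1, by simp [h1, h2]⟩
      · rintro p ⟨h1, h2⟩
        exact ⟨Or.inr h1, by simp [hmem h1, h2]⟩
    · refine dependsOn_sum _ fun t => dependsOn_sum _ fun t' x y h => congrArg _ ?_
      refine dependsOn_mul (hv t) (hv' t') ?_ ?_ h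
      · rintro p ⟨h1, h2⟩
        exact ⟨Or.inl h1, by simp [h1, h2]⟩
      · rintro p ⟨h1, h2⟩
        exact ⟨Or.inr h1, by simp [hmem h1, h2]⟩
  · refine ⟨fun k => if k ∈ B then κ k else !κ' k, ν, _, _, _, hν, fun c => ?_, fun c => ?_,
      fun ω => rfl⟩
    · refine dependsOn_sum _ fun t => dependsOn_sum _ fun t' x y h => congrArg _ ?_
      refine dependsOn_mul (hu t) (hv' t') ?_ ?_ h
      · rintro p ⟨h1, h2⟩
        exact ⟨Or.inl h1, by simp [h1, h2]⟩
      · rintro p ⟨h1, h2⟩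
        exact ⟨Or.inr h1, by simpa [hmem h1, Bool.eq_not] using h2⟩
    · refine dependsOn_sum _ fun t => dependsOn_sum _ fun t' x y h => congrArg _ ?_
      refine dependsOn_mul (hv t) (hu' t') ?_ ?_ h
      · rintro p ⟨h1, h2⟩
        exact ⟨Or.inl h1, by simp [h1, h2]⟩
      · rintro p ⟨h1, h2⟩
        exact ⟨Or.inr h1, by simp [hmem h1, h2]⟩
  -- Each summation index is doubled, one copy for each factor, and deltas force the copies to
  -- agree; the bit decomposition applies to these deltas.
  · have h1 : f ω * g ω = ∑ t, ∑ t₁, ∑ t', ∑ t₁',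
        ((if e t = e t₁ then 1 else 0) * (if e' t' = e' t₁' then 1 else 0)) *
          (u t ω * v t₁ ω * (u' t' ω * v' t₁' ω)) := by
      rw [hf, hg, Finset.sum_mul_sum]
      refine Finset.sum_congr rfl fun t _ => ?_
      rw [Finset.sum_eq_single t]
      · refine Finset.sum_congr rfl fun t' _ => ?_
        rw [Finset.sum_eq_single t']
        · simp
        · intro b _ hb
          simp [hb.symm]
        · simp
      · intro b _ hb
        simp [hb.symm]
      · simp
    have h2 : ∀ c, (∑ t, ∑ t', P c (e t) (e' t') * (u t ω * u' t' ω)) *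
        (∑ t, ∑ t', Q c (e t) (e' t') * (v t ω * v' t' ω)) = ∑ t, ∑ t₁, ∑ t', ∑ t₁',
        (P c (e t) (e' t') * Q c (e t₁) (e' t₁')) *
          (u t ω * v t₁ ω * (u' t' ω * v' t₁' ω)) := by
      intro c
      simp only [Finset.sum_mul_sum]
      refine Finset.sum_congr rfl fun t _ => Finset.sum_congr rfl fun t₁ _ =>
        Finset.sum_congr rfl fun t' _ => Finset.sum_congr rfl fun t₁' _ => by ring
    -- Here `v'` sits in the first factor, so its index `t₁'` is the one paired with `t`.
    have h3 : ∀ c, (∑ t, ∑ t', P' c (e t) (e' t') * (u t ω * v' t' ω)) *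
        (∑ t, ∑ t', Q' c (e t) (e' t') * (v t ω * u' t' ω)) = ∑ t, ∑ t₁, ∑ t', ∑ t₁',
        (P' c (e t) (e' t₁') * Q' c (e t₁) (e' t')) *
          (u t ω * v t₁ ω * (u' t' ω * v' t₁' ω)) := by
      intro c
      simp only [Finset.sum_mul_sum]
      refine Finset.sum_congr rfl fun t _ => Finset.sum_congr rfl fun t₁ _ => ?_
      rw [Finset.sum_comm]
      refine Finset.sum_congr rfl fun t' _ => Finset.sum_congr rfl fun t₁' _ => by ring
    simp only [h1, h2, h3, hPQ, add_mul, Finset.sum_add_distrib, Finset.sum_mul]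
    congr 1
    all_goals
      symm
      rw [Finset.sum_comm]
      refine Finset.sum_congr rfl fun t _ => ?_
      rw [Finset.sum_comm]
      refine Finset.sum_congr rfl fun t₁ _ => ?_
      rw [Finset.sum_comm]
      refine Finset.sum_congr rfl fun t' _ => ?_
      rw [Finset.sum_comm]

theorem IsSumOfSplits.mul {s c c' : ℕ} {f g : (ι × Bool → α) → F} (hB : Disjoint B B')
    (hf : IsSumOfSplits B (4 ^ s) c f) (hg : IsSumOfSplits B' (4 ^ s) c' g) :
    IsSumOfSplits (B ∪ B') (12 ^ s) (2 * (c * c')) (fun ω => f ω * g ω) := by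
  obtain ⟨σ, _, φ, hσ, hφ, hf⟩ := hf
  obtain ⟨σ', _, φ', hσ', hφ', hg⟩ := hg
  choose p q hp hq hpq using fun x x' => (hφ x).exists_mul_eq_add hB (hφ' x')
  refine ⟨Bool × σ × σ', inferInstance, fun z => if z.1 then p z.2.1 z.2.2 else q z.2.1 z.2.2,
    ?_, ?_, fun ω => ?_⟩
  · simp only [Fintype.card_prod, Fintype.card_bool]
    gcongr
  · rintro ⟨_ | _, x, x'⟩
    · exact hq x x'
    · exact hp x x'
  · simp only [hf, hg]
    rw [Finset.sum_mul_sum, Fintype.sum_prod_type]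
    simp [Fintype.sum_prod_type, hpq, Finset.sum_add_distrib]

theorem IsSumOfSplits.sum {σ : Type} [Fintype σ] {r c : ℕ} {f : (ι × Bool → α) → F}
    {g : σ → (ι × Bool → α) → F} (hg : ∀ x, IsSumOfSplits B r c (g x))
    (hf : ∀ ω, f ω = ∑ x, g x ω) : IsSumOfSplits B r (Fintype.card σ * c) f := by
  choose σ' i φ hc hφ h using hg
  refine ⟨Σ x, σ' x, inferInstance, fun z => φ z.1 z.2, ?_, fun z => hφ z.1 z.2, fun ω => ?_⟩
  · rw [Fintype.card_sigma]
    calc _ ≤ ∑ _x : σ, c := Finset.sum_le_sum fun x _ => hc x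
      _ = _ := by simp
  · rw [hf, Fintype.sum_sigma]
    exact Finset.sum_congr rfl fun x _ => h x ω

/-- A function of the pairs in a finite set `B` splits. -/
theorem hasSplit_of_dependsOn [DecidableEq ι] [Fintype α] [DecidableEq α] [Inhabited α]
    (B : Finset ι) {f : (ι × Bool → α) → F} (hf : DependsOn f {p | p.1 ∈ B}) :
    HasSplit (B : Set ι) (Fintype.card α ^ B.card) f := by
  obtain ⟨e⟩ : Nonempty ((B → α) ≃ Fin (Fintype.card (B → α))) := ⟨Fintype.equivFin _⟩
  -- The sum runs over the values `t` of the `false` halves on `B`: an indicator of `t` times `f`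
  -- with these values filled in. The default outside `B` is irrelevant to `f`.
  let mix : (B → α) → (ι × Bool → α) → ι × Bool → α := fun t ω p =>
    if p.2 then ω p else if h : p.1 ∈ B then t ⟨p.1, h⟩ else default
  refine ⟨fun _ => false, Fin (Fintype.card (B → α)), inferInstance,
    fun t ω => if (fun k : B => ω (k, false)) = e.symm t then 1 else 0,
    fun t ω => f (mix (e.symm t) ω), by simp, fun t x y h => ?_, fun t x y h => ?_, fun ω => ?_⟩
  · have : (fun k : B => x (k, false)) = fun k : B => y (k, false) :=
      funext fun k => h _ ⟨k.2, rfl⟩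
    simp only [this]
  · refine hf fun p hp => ?_
    by_cases h2 : p.2 = true
    · simpa [mix, h2] using h p ⟨hp, by simp [h2]⟩
    · simp [mix, h2]
  · rw [Equiv.sum_comp e.symm (fun t => (if (fun k : B => ω (k, false)) = t then 1 else 0) *
      f (mix t ω)), Finset.sum_eq_single fun k : B => ω (k, false)]
    · rw [if_pos rfl, one_mul]
      refine hf fun p hp => ?_
      obtain ⟨k, _ | _⟩ := p
      · have : k ∈ B := hp
        simp [mix, this]
      · simp [mix]
    · intro t _ ht
      rw [if_neg ht.symm, zero_mul]
    · simp

end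

/-! ## Ordered branching programs as products of matrices -/

/-- A 0/1 point selecting one variable per block isolates one coefficient. -/
theorem eval_tensorPoly {F : Type*} [Field F] {m q : ℕ} (A : (Fin m → Fin q) → F)
    (a : Fin m → Fin q) :
    MvPolynomial.eval (fun p : Fin m × Fin q => if p.2 = a p.1 then (1 : F) else 0)
      (tensorPoly A) = A a := by
  classical
  simp only [tensorPoly, map_sum, map_mul, MvPolynomial.eval_C, map_prod, MvPolynomial.eval_X]
  rw [Finset.sum_eq_single a]
  · simp
  · intro b _ hb
    obtain ⟨k, hk⟩ := Function.ne_iff.mp hb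
    rw [Finset.prod_eq_zero (Finset.mem_univ k) (if_neg hk), mul_zero]
  · simp

theorem sum_fin_dite_lt {F : Type*} [AddCommMonoid F] {w W : ℕ} (h : w ≤ W) (f : Fin w → F) :
    (∑ r : Fin W, if hr : (r : ℕ) < w then f ⟨r, hr⟩ else 0) = ∑ r, f r := by
  rw [Fin.sum_univ_eq_sum_range (fun r => if hr : r < w then f ⟨r, hr⟩ else 0) W,
    ← Finset.sum_subset (Finset.range_subset_range.mpr h) (fun r _ hr => by
      rw [dif_neg (by simpa using hr)]),
    ← Fin.sum_univ_eq_sum_range (fun r => if hr : r < w then f ⟨r, hr⟩ else 0) w]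
  simp

/-- The coefficients of the polynomial of an ordered program are entries of products of square
matrices of the size of the program. -/
theorem OrderedABP.exists_matrix {F : Type*} [Field F] {m q : ℕ} (B : OrderedABP F m q)
    {A : (Fin m → Fin q) → F} (hB : B.poly = tensorPoly A) :
    ∃ (G : ℕ → Fin q → Matrix (Fin B.size) (Fin B.size) F) (u v : Fin B.size → F),
      ∀ a : ℕ → Fin q, A (fun i => a i) =
        ∑ r, ∑ s, u r * ((List.range' 0 m).map fun l => G l (a l)).prod r s * v s := by
  have hw : ∀ k, B.width k ≤ B.size := fun k =>
    Finset.single_le_sum (f := B.width) (fun _ _ => Nat.zero_le _) (Finset.mem_univ k)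
  -- Layers are padded with zeros to a common square size, so that lists of them can be multiplied.
  let G : ℕ → Fin q → Matrix (Fin B.size) (Fin B.size) F := fun l x => Matrix.of fun r s =>
    if hl : l < m then
      if hr : (r : ℕ) < B.width (Fin.castSucc ⟨l, hl⟩) then
        if hs : (s : ℕ) < B.width (Fin.succ ⟨l, hl⟩) then B.coeff ⟨l, hl⟩ ⟨r, hr⟩ ⟨s, hs⟩ x else 0
      else 0
    else 0
  have hG : ∀ (i : Fin m) (x : Fin q) (r s : Fin B.size), G i x r s =
      if hr : (r : ℕ) < B.width i.castSucc then
        if hs : (s : ℕ) < B.width i.succ then B.coeff i ⟨r, hr⟩ ⟨s, hs⟩ x else 0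
      else 0 := fun i x r s => dif_pos i.2
  let u : Fin B.size → F := fun r => if hr : (r : ℕ) < B.width 0 then B.source ⟨r, hr⟩ else 0
  let v : Fin B.size → F := fun r =>
    if hr : (r : ℕ) < B.width (Fin.last m) then B.sink ⟨r, hr⟩ else 0
  refine ⟨G, u, v, fun a => ?_⟩
  let ev := MvPolynomial.eval (fun p : Fin m × Fin q => if p.2 = a p.1 then (1 : F) else 0)
  have hrow : ∀ k : Fin (m + 1), ∀ s : Fin B.size,
      (∑ r, u r * ((List.range' 0 (k : ℕ)).map fun l => G l (a l)).prod r s) =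
        if hs : (s : ℕ) < B.width k then ev (B.row k ⟨s, hs⟩) else 0 := by
    intro k
    induction k using Fin.induction with
    | zero =>
      intro s
      simp [Matrix.one_apply, u, OrderedABP.row, ev]
    | succ i ih =>
      intro s
      have h1 : (List.range' 0 ((i.succ : Fin (m + 1)) : ℕ)).map (fun l => G l (a l)) =
          (List.range' 0 ((i.castSucc : Fin (m + 1)) : ℕ)).map (fun l => G l (a l)) ++
            [G i (a i)] := by
        simp [List.range'_1_concat]
      rw [h1, List.prod_append, List.prod_singleton]
      simp only [Matrix.mul_apply, Finset.mul_sum]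
      rw [Finset.sum_comm]
      simp only [← mul_assoc, ← Finset.sum_mul, ih]
      by_cases hs : (s : ℕ) < B.width i.succ
      · rw [dif_pos hs]
        have h2 : B.row i.succ = Matrix.vecMul (B.row i.castSucc) (B.layer i) := by
          simp [OrderedABP.row]
        rw [h2]
        simp only [Matrix.vecMul, dotProduct, map_sum, map_mul]
        rw [← sum_fin_dite_lt (hw i.castSucc)]
        refine Finset.sum_congr rfl fun r _ => ?_
        by_cases hr : (r : ℕ) < B.width i.castSucc
        · rw [dif_pos hr, dif_pos hr]
          congr 1
          rw [hG, dif_pos hr, dif_pos hs]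
          simp [OrderedABP.layer, ev]
        · rw [dif_neg hr, dif_neg hr, zero_mul]
      · rw [dif_neg hs]
        refine Finset.sum_eq_zero fun r _ => ?_
        simp [hG, hs]
  rw [← eval_tensorPoly A (fun i => a i), ← hB, OrderedABP.poly, dotProduct, map_sum,
    Finset.sum_comm, ← sum_fin_dite_lt (hw (Fin.last m))]
  refine Finset.sum_congr rfl fun s _ => ?_
  have h := hrow (Fin.last m) s
  rw [Fin.val_last] at h
  rw [← Finset.sum_mul, h]
  by_cases hs : (s : ℕ) < B.width (Fin.last m)
  · simp [v, hs, ev]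
  · simp [v, hs]

/-! ## Cutting a product of matrices into blocks -/

section

variable {F : Type*} [Field F] {d n W : ℕ} [NeZero n]

/-- The row index at position `l`, and `0` past the end. -/
def rowIndex (ω : Fin d × Bool → Fin n) (l : ℕ) : Fin n :=
  if h : l < d then ω (⟨l, h⟩, false) else 0

/-- The column index at position `l - 1`, and `0` at both ends. -/
def colIndex (ω : Fin d × Bool → Fin n) (l : ℕ) : Fin n :=
  if h : l - 1 < d ∧ l ≠ 0 then ω (⟨l - 1, h.1⟩, true) else 0

/-- The product of the `k` matrices starting with number `p`, where the column index at the left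
end is replaced by `c`, and the one at the right end is required to be `c'`. -/
def matSegment (G : ℕ → Fin (n * n) → Matrix (Fin W) (Fin W) F) (p k : ℕ) (c c' : Fin n)
    (r s : Fin W) (ω : Fin d × Bool → Fin n) : F :=
  (if colIndex ω (p + k) = c' then 1 else 0) * ((List.range' p k).map fun l =>
    G l (finProdFinEquiv (if l = p then c else colIndex ω l, rowIndex ω l))).prod r s

/-- The positions from `p` to `p + k`. -/
def block (d p k : ℕ) : Finset (Fin d) := Finset.univ.filter fun i => p ≤ i ∧ (i : ℕ) < p + k

theorem card_block_le (d p k : ℕ) : (block d p k).card ≤ k := by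
  have h := Finset.card_le_card_of_injOn (s := block d p k) (t := Finset.Ico p (p + k))
    (fun i => (i : ℕ)) (fun i hi => by simpa [block] using hi)
    (fun _ _ _ _ h => Fin.ext h)
  simpa using h

/-- Factor `l` reads the row index of pair `l` but the column index of pair `l - 1`. Guessing the
latter at the left end and testing it at the right end confines a segment to its own pairs. -/
theorem dependsOn_matSegment (G : ℕ → Fin (n * n) → Matrix (Fin W) (Fin W) F) (p k : ℕ) (hk : 0 < k)
    (c c' : Fin n) (r s : Fin W) :
    DependsOn (matSegment (d := d) G p k c c' r s) {q | q.1 ∈ block d p k} := by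
  intro x y h
  have hcol : ∀ l, p < l → l ≤ p + k → colIndex x l = colIndex y l := by
    intro l h1 h2
    unfold colIndex
    split_ifs with h3
    · exact h _ (by simp [block]; omega)
    · rfl
  have hrow : ∀ l, p ≤ l → l < p + k → rowIndex x l = rowIndex y l := by
    intro l h1 h2
    unfold rowIndex
    split_ifs with h3
    · exact h _ (by simp [block]; omega)
    · rfl
  unfold matSegment
  rw [hcol (p + k) (by omega) le_rfl]
  refine congrArg _ (congrArg (fun l : List (Matrix (Fin W) (Fin W) F) => l.prod r s)
    (List.map_congr_left fun l hl => ?_))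
  rw [List.mem_range'_1] at hl
  rw [hrow l hl.1 hl.2]
  by_cases hlp : l = p
  · simp [hlp]
  · rw [if_neg hlp, if_neg hlp, hcol l (by omega) hl.2.le]

/-- The sum runs over the matrix index at the cut and the guessed column index there; the indicator
in the left segment keeps only the correct guess. -/
theorem matSegment_add (G : ℕ → Fin (n * n) → Matrix (Fin W) (Fin W) F) (p k k' : ℕ) (hk : 0 < k)
    (c c' : Fin n) (r s : Fin W) (ω : Fin d × Bool → Fin n) :
    matSegment G p (k + k') c c' r s ω = ∑ z : Fin W × Fin n,
      matSegment G p k c z.2 r z.1 ω * matSegment G (p + k) k' z.2 c' z.1 s ω := by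
  rw [Fintype.sum_prod_type]
  simp only [matSegment]
  have h1 : ∀ t : Fin W, (∑ z : Fin n, (if colIndex ω (p + k) = z then (1 : F) else 0) *
      ((List.range' p k).map fun l =>
        G l (finProdFinEquiv (if l = p then c else colIndex ω l, rowIndex ω l))).prod r t *
      ((if colIndex ω (p + k + k') = c' then 1 else 0) * ((List.range' (p + k) k').map fun l =>
        G l (finProdFinEquiv (if l = p + k then z else colIndex ω l, rowIndex ω l))).prod t s)) =
      ((List.range' p k).map fun l =>
        G l (finProdFinEquiv (if l = p then c else colIndex ω l, rowIndex ω l))).prod r t *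
      ((if colIndex ω (p + k + k') = c' then 1 else 0) * ((List.range' (p + k) k').map fun l =>
        G l (finProdFinEquiv (if l = p then c else colIndex ω l, rowIndex ω l))).prod t s) := by
    intro t
    rw [Finset.sum_eq_single (colIndex ω (p + k))]
    · rw [if_pos rfl, one_mul]
      refine congrArg _ (congrArg _ (congrArg
        (fun l : List (Matrix (Fin W) (Fin W) F) => l.prod t s)
        (List.map_congr_left fun l hl => ?_)))
      rw [List.mem_range'_1] at hl
      rw [if_neg (show l ≠ p by omega)]
      by_cases hlp : l = p + k
      · simp [hlp]
      · rw [if_neg hlp]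
    · intro z _ hz
      rw [if_neg hz.symm, zero_mul, zero_mul]
    · simp
  simp only [h1]
  rw [← List.range'_append_1, List.map_append, List.prod_append, Matrix.mul_apply, Finset.mul_sum,
    add_assoc]
  exact Finset.sum_congr rfl fun t _ => by ring

theorem block_union (d p k k' : ℕ) :
    (block d p k : Set (Fin d)) ∪ block d (p + k) k' = block d p (k + k') := by
  ext i
  simp [block]
  omega

theorem disjoint_block (d p k k' : ℕ) :
    Disjoint (block d p k : Set (Fin d)) (block d (p + k) k') := by
  rw [Set.disjoint_left]
  intro i
  simp [block]
  omega

/-- The segments of a product from `p` to `p + k` are sums of splits. -/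
def SegmentsSplit (d : ℕ) (G : ℕ → Fin (n * n) → Matrix (Fin W) (Fin W) F) (p k r₀ c₀ : ℕ) :
    Prop :=
  ∀ c c' r s, IsSumOfSplits (block d p k : Set (Fin d)) r₀ c₀ (matSegment G p k c c' r s)

theorem segmentsSplit_of_le (G : ℕ → Fin (n * n) → Matrix (Fin W) (Fin W) F) {p k r₀ : ℕ}
    (hk : 0 < k) (h : n ^ k ≤ r₀) : SegmentsSplit d G p k r₀ 1 := by
  intro c c' r s
  refine ((hasSplit_of_dependsOn _ (dependsOn_matSegment G p k hk c c' r s)).mono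
    (le_trans ?_ h)).isSumOfSplits
  rw [Fintype.card_fin]
  exact Nat.pow_le_pow_right (NeZero.pos n) (card_block_le d p k)

theorem SegmentsSplit.add {G : ℕ → Fin (n * n) → Matrix (Fin W) (Fin W) F} {p k k' e c₁ c₂ : ℕ}
    (hk : 0 < k) (h : SegmentsSplit d G p k (4 ^ e) c₁)
    (h' : SegmentsSplit d G (p + k) k' (4 ^ e) c₂) :
    SegmentsSplit d G p (k + k') (12 ^ e) (W * n * (2 * (c₁ * c₂))) := by
  intro c c' r s
  have := IsSumOfSplits.sum (fun z : Fin W × Fin n =>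
      (h c z.2 r z.1).mul (disjoint_block d p k k') (h' z.2 c' z.1 s))
    (matSegment_add G p k k' hk c c' r s)
  rw [block_union] at this
  simpa using this

theorem SegmentsSplit.mono {G : ℕ → Fin (n * n) → Matrix (Fin W) (Fin W) F} {p k r₀ r₁ c₀ : ℕ}
    (h : SegmentsSplit d G p k r₀ c₀) (hr : r₀ ≤ r₁) : SegmentsSplit d G p k r₁ c₀ :=
  fun c c' r s => (h c c' r s).mono hr

end

/-! ## Bounds on the PT-rank -/

theorem partialTranspose_partialTranspose {F : Type*} {n d : ℕ} (κ : Finset (Fin d))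
    (M : Matrix (Fin d → Fin n) (Fin d → Fin n) F) :
    partialTranspose κ (partialTranspose κ M) = M := by
  ext i j
  simp only [partialTranspose, Matrix.of_apply]
  congr 1 <;> ext k <;> by_cases hk : k ∈ κ <;> simp [hk]

section

variable {F : Type*} [Field F] {n d : ℕ}

theorem ptBasic_of_rank_le_one {κ : Finset (Fin d)}
    {P : Matrix (Fin d → Fin n) (Fin d → Fin n) F} (h : (partialTranspose κ P).rank ≤ 1)
    (hP : P ≠ 0) : PTBasic P := by
  refine ⟨κ, le_antisymm h (Nat.one_le_iff_ne_zero.mpr fun h0 => hP ?_)⟩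
  have h1 : (partialTranspose κ P).mulVecLin = 0 :=
    LinearMap.range_eq_bot.mp (Submodule.finrank_eq_zero.mp h0)
  have h2 : partialTranspose κ P = 0 := by
    ext i j
    simpa using congrFun (LinearMap.congr_fun h1 (Pi.single j 1)) i
  rw [← partialTranspose_partialTranspose κ P, h2]
  rfl

/-- Zero matrices are not PT-basic, so zero summands are discarded before counting. -/
theorem ptRank_le_card {σ : Type*} [Fintype σ] {M : Matrix (Fin d → Fin n) (Fin d → Fin n) F}
    (P : σ → Matrix (Fin d → Fin n) (Fin d → Fin n) F)
    (hP : ∀ x, ∃ κ, (partialTranspose κ (P x)).rank ≤ 1) (hM : M = ∑ x, P x) :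
    ptRank M ≤ Fintype.card σ := by
  classical
  let e := Fintype.equivFin {x // P x ≠ 0}
  have h : IsPTSum M (Fintype.card {x // P x ≠ 0}) := by
    refine ⟨fun t => P (e.symm t).1, fun t => ?_, ?_⟩
    · obtain ⟨κ, hκ⟩ := hP (e.symm t).1
      exact ptBasic_of_rank_le_one hκ (e.symm t).2
    · rw [hM, Equiv.sum_comp e.symm (fun x => P x.1),
        ← Finset.sum_subtype (Finset.univ.filter fun x => P x ≠ 0) (by simp) P,
        Finset.sum_filter_ne_zero]
  exact (Nat.sInf_le h).trans (Fintype.card_subtype_le _)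

/-- The row and column indices of a matrix as one family. -/
def joinIndex (i j : Fin d → Fin n) : Fin d × Bool → Fin n := fun p => if p.2 then j p.1 else i p.1

/-- Transposing at the pairs whose column index belongs to `u` makes `u` a function of the rows and
`v` one of the columns, an outer product. -/
theorem ptRank_le_of_isSumOfSplits {r c : ℕ} {f : (Fin d × Bool → Fin n) → F}
    (hf : IsSumOfSplits Set.univ r c f) {M : Matrix (Fin d → Fin n) (Fin d → Fin n) F}
    (hM : ∀ i j, M i j = f (joinIndex i j)) : ptRank M ≤ c * r := by
  classical
  obtain ⟨σ, _, g, hσ, hg, hf⟩ := hf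
  choose κ τ i u v hτ hu hv hg using hg
  refine (ptRank_le_card (σ := Σ x, τ x)
    (fun z => Matrix.of fun i j => u z.1 z.2 (joinIndex i j) * v z.1 z.2 (joinIndex i j))
    (fun z => ⟨Finset.univ.filter fun k => κ z.1 k = true, ?_⟩) ?_).trans ?_
  · have h : partialTranspose (Finset.univ.filter fun k => κ z.1 k = true)
        (Matrix.of fun i j => u z.1 z.2 (joinIndex i j) * v z.1 z.2 (joinIndex i j)) =
        Matrix.vecMulVec (fun i => u z.1 z.2 fun p => i p.1) (fun j => v z.1 z.2 fun p => j p.1) := by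
      ext i j
      simp only [partialTranspose, Matrix.of_apply, Matrix.vecMulVec_apply]
      congr 1
      · refine hu z.1 z.2 fun p hp => ?_
        have h2 := hp.2
        obtain ⟨k, b⟩ := p
        cases hκ : κ z.1 k <;> simp_all [joinIndex]
      · refine hv z.1 z.2 fun p hp => ?_
        have h2 := hp.2
        obtain ⟨k, b⟩ := p
        cases hκ : κ z.1 k <;> simp_all [joinIndex]
    rw [h]
    exact Matrix.rank_vecMulVec_le _ _
  · ext i j
    rw [hM, hf, Matrix.sum_apply, Fintype.sum_sigma]
    exact Finset.sum_congr rfl fun x _ => by simp [hg]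
  · rw [Fintype.card_sigma]
    calc ∑ x, Fintype.card (τ x) ≤ ∑ _x : σ, r := Finset.sum_le_sum fun x _ => hτ x
      _ = Fintype.card σ * r := by simp
      _ ≤ c * r := Nat.mul_le_mul_right r hσ

theorem ptRank_le_pow [NeZero n] (M : Matrix (Fin d → Fin n) (Fin d → Fin n) F) :
    ptRank M ≤ n ^ d := by
  have h := (hasSplit_of_dependsOn (F := F) (Finset.univ : Finset (Fin d))
    (f := fun ω : Fin d × Bool → Fin n => M (fun k => ω (k, false)) (fun k => ω (k, true)))
    (fun x y h => by
      simp only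
      congr 1 <;> ext k <;> rw [h _ (by simp)])).isSumOfSplits
  rw [Finset.coe_univ] at h
  simpa using ptRank_le_of_isSumOfSplits h (M := M) fun i j => by simp [joinIndex]

theorem HasSplit.const_mul {ι α : Type*} {B : Set ι} {r : ℕ} {f : (ι × Bool → α) → F} (a : F)
    (h : HasSplit B r f) : HasSplit B r fun ω => a * f ω := by
  obtain ⟨κ, τ, _, u, v, hc, hu, hv, h⟩ := h
  refine ⟨κ, τ, _, fun t ω => a * u t ω, v, hc, fun t x y hxy => ?_, hv, fun ω => ?_⟩
  · simp only
    rw [hu t hxy]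
  · simp only [h, Finset.mul_sum, mul_assoc]

theorem IsSumOfSplits.const_mul {ι α : Type*} {B : Set ι} {r c : ℕ} {f : (ι × Bool → α) → F}
    (a : F) (h : IsSumOfSplits B r c f) : IsSumOfSplits B r c fun ω => a * f ω := by
  obtain ⟨σ, _, g, hc, hg, h⟩ := h
  exact ⟨σ, _, fun x ω => a * g x ω, hc, fun x => (hg x).const_mul a, fun ω => by
    simp only [h, Finset.mul_sum]⟩

/-- The PT-rank of a matrix whose shifted tensor has an ordered program, from four blocks of
positions. -/
theorem ptRank_le_of_orderedABP [NeZero n] {M : Matrix (Fin d → Fin n) (Fin d → Fin n) F}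
    (B : OrderedABP F (d + 1) (n * n)) (hB : B.poly = tensorPoly (shiftedTensor M)) (hd : 4 ≤ d)
    {s t : ℕ} (hs : n ^ (d / 4 + 4) ≤ 4 ^ s) (ht : 12 ^ s ≤ 4 ^ t) :
    ptRank M ≤ 8 * B.size ^ 5 * n ^ 3 * 12 ^ t := by
  obtain ⟨G, u, v, hG⟩ := B.exists_matrix hB
  set L := d / 4 with hL
  have hpow : ∀ k, k ≤ L + 4 → n ^ k ≤ 4 ^ s := fun k hk =>
    (Nat.pow_le_pow_right (NeZero.pos n) hk).trans hs
  have h0 : SegmentsSplit d G 0 L (4 ^ s) 1 :=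
    segmentsSplit_of_le G (by omega) (hpow _ (by omega))
  have h1 : SegmentsSplit d G (0 + L) L (4 ^ s) 1 :=
    segmentsSplit_of_le G (by omega) (hpow _ (by omega))
  have h2 : SegmentsSplit d G (0 + (L + L)) L (4 ^ s) 1 :=
    segmentsSplit_of_le G (by omega) (hpow _ (by omega))
  -- The last segment takes the remainder of `d` modulo 4 and the extra factor, hence up to `L + 4`
  -- factors.
  have h3 : SegmentsSplit d G (0 + (L + L) + L) (d + 1 - 3 * L) (4 ^ s) 1 :=
    segmentsSplit_of_le G (by omega) (hpow _ (by omega))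
  have h := ((h0.add (by omega) h1).mono ht).add (by omega) ((h2.add (by omega) h3).mono ht)
  rw [show L + L + (L + (d + 1 - 3 * L)) = d + 1 by omega] at h
  have hblock : (block d 0 (d + 1) : Set (Fin d)) = Set.univ := by
    ext i
    simp [block]
  have hsum := IsSumOfSplits.sum (σ := Fin B.size × Fin B.size)
    (f := fun ω => ∑ z : Fin B.size × Fin B.size, u z.1 * v z.2 * matSegment G 0 (d + 1) 0 0 z.1 z.2 ω)
    (fun z : Fin B.size × Fin B.size => (h 0 0 z.1 z.2).const_mul (u z.1 * v z.2)) (fun _ => rfl)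
  rw [hblock] at hsum
  -- Three cuts give `(2 * W * n) ^ 3`, and the two boundary vectors give `W ^ 2`.
  refine (ptRank_le_of_isSumOfSplits hsum (M := M) fun i j => ?_).trans (le_of_eq ?_)
  · have h4 := hG fun l => finProdFinEquiv
      (if l = 0 then 0 else colIndex (joinIndex i j) l, rowIndex (joinIndex i j) l)
    have h5 : shiftedTensor M (fun l : Fin (d + 1) => finProdFinEquiv
      (if (l : ℕ) = 0 then 0 else colIndex (joinIndex i j) l, rowIndex (joinIndex i j) l)) =
        M i j := by
      have hi : (fun k : Fin d => rowIndex (joinIndex i j) k) = i := by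
        ext k
        simp [rowIndex, joinIndex]
      have hj : (fun k : Fin d => colIndex (joinIndex i j) (k + 1)) = j := by
        ext k
        simp [colIndex, joinIndex]
      simp only [shiftedTensor, Equiv.symm_apply_apply]
      -- The value `0` past the ends is the index required of `p` and `q` in the shifted tensor.
      rw [if_pos ⟨by simp, by simp [rowIndex]⟩]
      simp only [Fin.val_succ, Nat.add_one_ne_zero, if_false, hj, Fin.val_castSucc, hi]
    rw [← h5, h4, Fintype.sum_prod_type]
    refine Finset.sum_congr rfl fun r _ => Finset.sum_congr rfl fun t _ => ?_
    have h6 : colIndex (joinIndex i j) (0 + (d + 1)) = 0 := by simp [colIndex]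
    rw [matSegment, if_pos h6]
    ring
  · simp only [Fintype.card_prod, Fintype.card_fin]
    ring

end

/-! ## Asymptotics -/

/-- A polynomial is bounded by an exponential of small rate. -/
theorem exists_const_mul_pow_le_two_rpow (K : ℝ) (c : ℕ) :
    ∃ D : ℝ, ∀ d : ℕ, K * ((d : ℝ) + 1) ^ c ≤ (2 : ℝ) ^ (0.006 * (d : ℝ) + D) := by
  have h2 : (1 : ℝ) < (2 : ℝ) ^ (0.006 : ℝ) := Real.one_lt_rpow (by norm_num) (by norm_num)
  have h := (tendsto_pow_const_div_const_pow_of_one_lt c h2).comp (Filter.tendsto_add_atTop_nat 1)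
  obtain ⟨A, hA⟩ := h.bddAbove_range
  have hA' : ∀ d : ℕ, ((d : ℝ) + 1) ^ c ≤ max A 1 * (2 : ℝ) ^ (0.006 * ((d : ℝ) + 1)) := by
    intro d
    have h3 := hA ⟨d, rfl⟩
    simp only [Function.comp_apply, Nat.cast_add, Nat.cast_one] at h3
    rw [div_le_iff₀ (by positivity)] at h3
    refine h3.trans ?_
    rw [Real.rpow_mul (by norm_num), ← Nat.cast_one (R := ℝ), ← Nat.cast_add, Real.rpow_natCast]
    gcongr
    simp
  have hpos : 0 < max K 1 * max A 1 * (2 : ℝ) ^ (0.006 : ℝ) := by positivity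
  refine ⟨Real.logb 2 (max K 1 * max A 1 * (2 : ℝ) ^ (0.006 : ℝ)), fun d => ?_⟩
  rw [Real.rpow_add (by norm_num), Real.rpow_logb (by norm_num) (by norm_num) hpos]
  calc K * ((d : ℝ) + 1) ^ c ≤ max K 1 * (max A 1 * (2 : ℝ) ^ (0.006 * ((d : ℝ) + 1))) := by
        gcongr
        · exact le_max_left _ _
        · exact hA' d
    _ = _ := by
        rw [mul_add, Real.rpow_add (by norm_num), mul_one]
        ring

/-- Powers of four between which two merging steps fit, with total exponent close to the square of
`52 / 29`. -/
theorem exists_merge_exponents {x : ℕ} (hx : 1 ≤ x) :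
    ∃ s t : ℕ, x ≤ 4 ^ s ∧ 12 ^ s ≤ 4 ^ t ∧
      ((12 ^ t : ℕ) : ℝ) ≤ (4 : ℝ) ^ 2704 * (x : ℝ) ^ (2704 / 841 : ℝ) := by
  -- `52 / 29` is slightly above `log_4 12`. Multiples of `841 = 29 ^ 2` keep the exponents integral
  -- through both merges: `841`, `1508 = 29 * 52`, `2704 = 52 ^ 2`. Rounding `y` up costs the factor
  -- `4 ^ 2704`.
  have h12 : 12 ^ 29 ≤ 4 ^ 52 := by norm_num
  set y : ℝ := Real.logb 4 x / 841 with hy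
  have hxpos : (0 : ℝ) < x := by exact_mod_cast hx
  have hy0 : 0 ≤ y := by
    have : 0 ≤ Real.logb 4 x := Real.logb_nonneg (by norm_num) (by exact_mod_cast hx)
    positivity
  have hx4 : (x : ℝ) = (4 : ℝ) ^ (841 * y) := by
    rw [hy, mul_div_cancel₀ _ (by norm_num), Real.rpow_logb (by norm_num) (by norm_num) hxpos]
  refine ⟨841 * ⌈y⌉₊, 1508 * ⌈y⌉₊, ?_, ?_, ?_⟩
  · have : (x : ℝ) ≤ ((4 ^ (841 * ⌈y⌉₊) : ℕ) : ℝ) := by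
      rw [hx4, Nat.cast_pow, ← Real.rpow_natCast]
      push_cast
      exact Real.rpow_le_rpow_of_exponent_le (by norm_num) (by linarith [Nat.le_ceil y])
    exact_mod_cast this
  · calc 12 ^ (841 * ⌈y⌉₊) = (12 ^ 29) ^ (29 * ⌈y⌉₊) := by rw [← pow_mul]; ring_nf
      _ ≤ (4 ^ 52) ^ (29 * ⌈y⌉₊) := Nat.pow_le_pow_left h12 _
      _ = 4 ^ (1508 * ⌈y⌉₊) := by rw [← pow_mul]; ring_nf
  · have h1 : 12 ^ (1508 * ⌈y⌉₊) ≤ 4 ^ (2704 * ⌈y⌉₊) := by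
      calc 12 ^ (1508 * ⌈y⌉₊) = (12 ^ 29) ^ (52 * ⌈y⌉₊) := by rw [← pow_mul]; ring_nf
        _ ≤ (4 ^ 52) ^ (52 * ⌈y⌉₊) := Nat.pow_le_pow_left h12 _
        _ = 4 ^ (2704 * ⌈y⌉₊) := by rw [← pow_mul]; ring_nf
    have h2 : ((4 : ℝ) ^ (841 * y)) ^ (2704 / 841 : ℝ) = (4 : ℝ) ^ (2704 * y) := by
      rw [← Real.rpow_mul (by norm_num)]
      ring_nf
    rw [hx4, h2, ← Real.rpow_natCast 4 2704, ← Real.rpow_add (by norm_num)]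
    calc ((12 ^ (1508 * ⌈y⌉₊) : ℕ) : ℝ) ≤ ((4 ^ (2704 * ⌈y⌉₊) : ℕ) : ℝ) := by exact_mod_cast h1
      _ = (4 : ℝ) ^ ((2704 : ℝ) * ⌈y⌉₊) := by
        rw [Nat.cast_pow, ← Real.rpow_natCast]
        push_cast
        rfl
      _ ≤ _ := by
        refine Real.rpow_le_rpow_of_exponent_le (by norm_num) ?_
        push_cast
        linarith [(Nat.ceil_lt_add_one hy0).le]

theorem theorem6 {F : Type*} [Field F] (hF : ringChar F ≠ 2)
    (n d : ℕ → ℕ) (hn : ∀ k, 1 ≤ n k) (hd : ∀ k, 1 ≤ d k)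
    (M : ∀ k, Matrix (Fin (d k) → Fin (n k)) (Fin (d k) → Fin (n k)) F)
    (hM : VBPord (fun k => shiftedTensor (M k))) :
    ∃ C : ℝ, ∀ k, (ptRank (M k) : ℝ) ≤ (n k : ℝ) ^ (0.81 * (d k : ℝ) + C) := by
  obtain ⟨c, hc⟩ := hM
  obtain ⟨D, hD⟩ := exists_const_mul_pow_le_two_rpow ((1 + c) ^ 5) (5 * c)
  -- The proof collects `3 + 3 + 5408 + 13 = 5427`: from the factor 8, from the cuts, from rounding
  -- to powers of four, and from the four extra positions of a block.
  refine ⟨|D| + 10 * c + 5430, fun k => ?_⟩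
  have hn1 : (1 : ℝ) ≤ n k := by exact_mod_cast hn k
  have hn0 : (0 : ℝ) < n k := by linarith
  have : NeZero (n k) := ⟨Nat.one_le_iff_ne_zero.mp (hn k)⟩
  have hd0 : (0 : ℝ) ≤ d k := Nat.cast_nonneg _
  -- For `n = 1` no power of `n` absorbs a constant, but the trivial bound is already `1`. Otherwise
  -- `n ≥ 2` turns constants into powers of `n`.
  rcases (hn k).eq_or_lt with h1 | h2
  · have h : (ptRank (M k) : ℝ) ≤ (n k : ℝ) ^ d k := by exact_mod_cast ptRank_le_pow (M k)
    have h3 : (n k : ℝ) = 1 := by exact_mod_cast h1.symm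
    rw [h3, one_pow] at h
    rwa [h3, Real.one_rpow]
  rcases lt_or_ge (d k) 4 with h4 | h4
  · have h : (ptRank (M k) : ℝ) ≤ (n k : ℝ) ^ (d k : ℝ) := by
      rw [Real.rpow_natCast]
      exact_mod_cast ptRank_le_pow (M k)
    refine h.trans (Real.rpow_le_rpow_of_exponent_le hn1 ?_)
    have : (d k : ℝ) ≤ 4 := by exact_mod_cast h4.le
    linarith [abs_nonneg D, (Nat.cast_nonneg c : (0 : ℝ) ≤ c)]
  obtain ⟨B, hB, hsize⟩ := hc k
  obtain ⟨s, t, hs, hst, ht⟩ := exists_merge_exponents (x := n k ^ (d k / 4 + 4))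
    (Nat.one_le_pow _ _ (hn k))
  have hn2 : (2 : ℝ) ≤ n k := by exact_mod_cast h2
  have hrank : (ptRank (M k) : ℝ) ≤ 8 * (B.size : ℝ) ^ 5 * (n k : ℝ) ^ 3 * ((12 ^ t : ℕ) : ℝ) := by
    exact_mod_cast ptRank_le_of_orderedABP B hB h4 hs hst
  have hW : (B.size : ℝ) ^ 5 ≤
      (n k : ℝ) ^ (0.006 * (d k : ℝ) + |D|) * (n k : ℝ) ^ (10 * c : ℝ) := by
    have hW1 : (B.size : ℝ) ≤ (1 + c) * (((d k : ℝ) + 1) ^ c * (n k : ℝ) ^ (2 * c)) := by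
      have h5 : (B.size : ℝ) ≤ (((d k : ℝ) + 1) * (n k * n k)) ^ c + c := by exact_mod_cast hsize
      have h6 : (((d k : ℝ) + 1) * (n k * n k)) ^ c = ((d k : ℝ) + 1) ^ c * (n k : ℝ) ^ (2 * c) := by
        rw [mul_pow, ← sq, ← pow_mul]
      have h7 : 1 ≤ ((d k : ℝ) + 1) ^ c * (n k : ℝ) ^ (2 * c) :=
        one_le_mul_of_one_le_of_one_le (one_le_pow₀ (by linarith)) (one_le_pow₀ hn1)
      rw [h6] at h5
      nlinarith [(Nat.cast_nonneg c : (0 : ℝ) ≤ c)]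
    calc (B.size : ℝ) ^ 5 ≤ ((1 + c) * (((d k : ℝ) + 1) ^ c * (n k : ℝ) ^ (2 * c))) ^ 5 := by gcongr
      _ = ((1 + c) ^ 5 * ((d k : ℝ) + 1) ^ (5 * c)) * (n k : ℝ) ^ (10 * c) := by ring
      _ ≤ (n k : ℝ) ^ (0.006 * (d k : ℝ) + |D|) * (n k : ℝ) ^ (10 * c) := by
        gcongr
        calc _ ≤ (2 : ℝ) ^ (0.006 * (d k : ℝ) + D) := hD (d k)
          _ ≤ (2 : ℝ) ^ (0.006 * (d k : ℝ) + |D|) :=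
            Real.rpow_le_rpow_of_exponent_le (by norm_num) (by linarith [le_abs_self D])
          _ ≤ _ := Real.rpow_le_rpow (by norm_num) hn2 (by positivity)
      _ = _ := by
        rw [← Real.rpow_natCast (n k : ℝ) (10 * c)]
        push_cast
        rfl
  have h8 : (8 : ℝ) ≤ (n k : ℝ) ^ (3 : ℝ) := by
    calc (8 : ℝ) = 2 ^ (3 : ℝ) := by norm_num
      _ ≤ _ := Real.rpow_le_rpow (by norm_num) hn2 (by norm_num)
  have h4' : (4 : ℝ) ^ 2704 ≤ (n k : ℝ) ^ (5408 : ℝ) := by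
    calc (4 : ℝ) ^ 2704 = (2 : ℝ) ^ (5408 : ℝ) := by
          rw [← Real.rpow_natCast, show (4 : ℝ) = 2 ^ (2 : ℝ) by norm_num,
            ← Real.rpow_mul (by norm_num)]
          norm_num
      _ ≤ _ := Real.rpow_le_rpow (by norm_num) hn2 (by norm_num)
  -- Numerically, `2704 / 841 / 4 < 0.804` and `4 * 2704 / 841 < 13`.
  have hblock : (((n k ^ (d k / 4 + 4) : ℕ) : ℝ)) ^ (2704 / 841 : ℝ) ≤
      (n k : ℝ) ^ (0.804 * (d k : ℝ) + 13) := by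
    rw [Nat.cast_pow, ← Real.rpow_natCast, ← Real.rpow_mul hn0.le]
    refine Real.rpow_le_rpow_of_exponent_le hn1 ?_
    have : ((d k / 4 : ℕ) : ℝ) ≤ (d k : ℝ) / 4 := Nat.cast_div_le
    push_cast
    nlinarith
  calc (ptRank (M k) : ℝ) ≤ 8 * (B.size : ℝ) ^ 5 * (n k : ℝ) ^ 3 * ((12 ^ t : ℕ) : ℝ) := hrank
    _ ≤ (n k : ℝ) ^ (3 : ℝ) *
        ((n k : ℝ) ^ (0.006 * (d k : ℝ) + |D|) * (n k : ℝ) ^ (10 * c : ℝ)) *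
        (n k : ℝ) ^ (3 : ℝ) * ((n k : ℝ) ^ (5408 : ℝ) * (n k : ℝ) ^ (0.804 * (d k : ℝ) + 13)) := by
      have h3 : (n k : ℝ) ^ 3 = (n k : ℝ) ^ (3 : ℝ) := by
        rw [← Real.rpow_natCast]
        norm_num
      rw [h3]
      refine mul_le_mul (mul_le_mul_of_nonneg_right (mul_le_mul h8 hW ?_ ?_) ?_)
        (ht.trans (mul_le_mul h4' hblock ?_ ?_)) ?_ ?_
      all_goals positivity
    _ = (n k : ℝ) ^ (3 + (0.006 * (d k : ℝ) + |D| + 10 * c) + 3 +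
        (5408 + (0.804 * (d k : ℝ) + 13))) := by
      simp only [Real.rpow_add hn0]
    _ ≤ _ := Real.rpow_le_rpow_of_exponent_le hn1 (by linarith)
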